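/- Let $G$ be a finite simple graph. A proper $k$-coloring of $G$ is a map $f$ from $V(G)$ onto $[k]=\{1,\dots,k\}$ that gives different colors to adjacent vertices. It is called neighbor locating if $f(N_G(u))\neq f(N_G(v))$ for any two distinct vertices $u,v$ with $f(u)=f(v)$, where $N_G(u)$ is the set of neighbors of $u$ and $f(S)=\{f(x) : x\in S\}$. The neighbor locating chromatic number $\chi_{L_2}(G)$ is the minimum $k$ for which $G$ has a neighbor locating $k$-coloring. Theorem. Let $n\ge 2$ be an integer, let $P_n=v_1v_2\cdots v_n$ be the path on $n$ vertices, and let $m:=\min\{k\in\mathbb{N} : n\le \tfrac12(k^3-k^2)\}$. Then $\chi_{L_2}(P_n)=m$. Moreover, there is a neighbor locating $m$-coloring $f_n$ of $P_n$ such that (1) $f_n(v_{n-1})=2$ and $f_n(v_n)=1$; (2) if $n\ge 9$, then also $f_n(v_{n-2})=m$; (3) if $n\ge 9$ and $n\ne \tfrac12(m^3-m^2)-1$, then also $f_n(v_1)=2$ and $f_n(v_2)=1$. -/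

import Mathlib

/-- A proper `k`-coloring of a graph: a function from the vertices *onto* the set of colors
`{1, ..., k}` that gives different colors to adjacent vertices. -/
def IsProperColoring {V : Type*} (G : SimpleGraph V) (k : ℕ) (f : V → ℕ) : Prop :=
  Set.range f = Set.Icc 1 k ∧ ∀ u v : V, G.Adj u v → f u ≠ f v

/-- A neighbor locating `k`-coloring: a proper `k`-coloring such that any two distinct vertices of
the same color have different sets of colors on their neighborhoods. -/
def IsNeighborLocatingColoring {V : Type*} (G : SimpleGraph V) (k : ℕ) (f : V → ℕ) : Prop :=
  IsProperColoring G k f ∧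
    ∀ u v : V, u ≠ v → f u = f v → f '' G.neighborSet u ≠ f '' G.neighborSet v

/-- The neighbor locating chromatic number: the minimum number of colors in a neighbor locating
coloring (and `⊤` if there is no such coloring with finitely many colors). -/
noncomputable def neighborLocatingChromaticNumber {V : Type*} (G : SimpleGraph V) : ℕ∞ :=
  ⨅ k ∈ {k : ℕ | ∃ f : V → ℕ, IsNeighborLocatingColoring G k f}, (k : ℕ∞)

/-! In a neighbor locating coloring every vertex is determined by its color and the color set of its
neighbors. When that set is a singleton, adding the vertex's own color turns it into a pair without
losing information, so `c` colors serve at most `c * c.choose 2` vertices (`le_of_locating`). This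
gives the lower bound on the chromatic number.

For the construction, a coloring is a word with one extra reflected letter at each end, so that end
vertices look like inner ones. The coloring is locating once the triples (color, set of the two
adjacent colors) are distinct. Possible triples are grouped by their full color set: three for a
3-set (a triangle), two for a 2-set (an edge, whose two triples are called loops). Replacing a
consecutive `a b` by `a b c a b` adds exactly the triples of `{a, b, c}`, and replacing it by `a b a
b` adds exactly those of `{a, b}`; all old triples survive. Starting from a short word with the
prescribed ends, lengths thus grow by 3 or 2. The length one below the maximum must omit a single
triple, so it needs its own starting word, with a different beginning. Paths with at most 9 vertices
are colored explicitly. -/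

/-! ### Words, their triples, and neighborhoods in a path -/

/-- The color of each inner position of a word together with the set of the two colors next to it. -/
def tripleList : List ℕ → List (ℕ × Finset ℕ)
  | a :: b :: c :: l => (b, {a, c}) :: tripleList (b :: c :: l)
  | _ => []

theorem tripleList_append (a b : ℕ) (v : List ℕ) : ∀ u : List ℕ,
    tripleList (u ++ a :: b :: v) = tripleList (u ++ [a, b]) ++ tripleList (a :: b :: v)
  | [] => by simp [tripleList]
  | [x] => by simp [tripleList]
  | [x, y] => by simp [tripleList]
  | x :: y :: z :: u => by
    have h := tripleList_append a b v (y :: z :: u)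
    simp only [List.cons_append] at h
    simp [tripleList, h]

theorem length_tripleList : ∀ W : List ℕ, (tripleList W).length = W.length - 2
  | [] => rfl
  | [_] => rfl
  | [_, _] => rfl
  | a :: b :: c :: l => by
    have h := length_tripleList (b :: c :: l)
    simp only [tripleList, List.length_cons] at h ⊢
    omega

theorem getElem?_tripleList : ∀ (W : List ℕ) (i : ℕ), i + 2 < W.length →
    (tripleList W)[i]? = some (W.getD (i + 1) 0, {W.getD i 0, W.getD (i + 2) 0})
  | [], i, h => by simp at h
  | [_], i, h => by simp at h
  | [_, _], i, h => by simp at h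
  | a :: b :: c :: l, 0, h => by simp [tripleList]
  | a :: b :: c :: l, i + 1, h => by
    have := getElem?_tripleList (b :: c :: l) i (by simp at h ⊢; omega)
    simpa [tripleList] using this

/-- Vertex `i` carries the letter `g (i + 1)`. The letters `g 0` and `g (n + 1)` belong to no
vertex; by reflection they repeat the only neighbor color of an end vertex. -/
theorem pathGraph_neighborSet_image {n : ℕ} (hn : 2 ≤ n) (g : ℕ → ℕ) (h0 : g 0 = g 2)
    (hl : g (n + 1) = g (n - 1)) (i : Fin n) :
    (fun j : Fin n => g (j + 1)) '' (SimpleGraph.pathGraph n).neighborSet i =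
      {g i, g (i + 2)} := by
  obtain ⟨i, hi⟩ := i
  ext x
  simp only [Set.mem_image, SimpleGraph.mem_neighborSet, SimpleGraph.pathGraph_adj,
    Set.mem_insert_iff, Set.mem_singleton_iff]
  constructor
  · rintro ⟨⟨j, hj⟩, h | h, rfl⟩
    · right; simp only at h; subst h; rfl
    · left; simp only at h; subst h; rfl
  · have hpred : 0 < i → ∃ j : Fin n, (i + 1 = j.1 ∨ j.1 + 1 = i) ∧ g (j.1 + 1) = g i :=
      fun hpos => ⟨⟨i - 1, by omega⟩, by simp only; omega, by congr 1; simp only; omega⟩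
    have hsucc : i + 1 < n → ∃ j : Fin n, (i + 1 = j.1 ∨ j.1 + 1 = i) ∧ g (j.1 + 1) = g (i + 2) :=
      fun hlt => ⟨⟨i + 1, hlt⟩, by simp, rfl⟩
    rintro (rfl | rfl)
    · rcases Nat.eq_zero_or_pos i with rfl | hpos
      · simpa only [h0] using hsucc (by omega)
      · exact hpred hpos
    · rcases Nat.lt_or_ge (i + 1) n with hlt | hge
      · exact hsucc hlt
      · have : i + 2 = n + 1 := by omega
        have h2 : i = n - 1 := by omega
        rw [this, hl, ← h2]
        exact hpred (by omega)

/-! ### The counting bound -/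

/-- A path has at most `c * c.choose 2` vertices if a neighbor locating coloring uses `c` colors. -/
theorem le_of_locating {n : ℕ} (hn : 2 ≤ n) (f : Fin n → ℕ)
    (hadj : ∀ u v, (SimpleGraph.pathGraph n).Adj u v → f u ≠ f v)
    (hloc : ∀ u v, u ≠ v → f u = f v → f '' (SimpleGraph.pathGraph n).neighborSet u ≠
      f '' (SimpleGraph.pathGraph n).neighborSet v) (C : Finset ℕ) (hC : ∀ v, f v ∈ C) :
    n ≤ C.card * C.card.choose 2 := by
  classical
  have key : ∀ i : Fin n, ∃ s : Finset ℕ, (s : Set ℕ) = f '' (SimpleGraph.pathGraph n).neighborSet i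
      ∧ s ⊆ C ∧ f i ∉ s ∧ (s.card = 1 ∨ s.card = 2) := by
    intro i
    have hsub : ∃ t : Finset (Fin n), (t : Set (Fin n)) = (SimpleGraph.pathGraph n).neighborSet i ∧
        t.Nonempty ∧ t.card ≤ 2 := by
      obtain ⟨i, hi⟩ := i
      refine ⟨Finset.univ.filter (fun j => i + 1 = j.1 ∨ j.1 + 1 = i), ?_, ?_, ?_⟩
      · ext j; simp [SimpleGraph.pathGraph_adj]
      · by_cases h : i + 1 < n
        · exact ⟨⟨i + 1, h⟩, by simp⟩
        · exact ⟨⟨i - 1, by omega⟩, by simp; omega⟩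
      · calc _ = ((Finset.univ.filter (fun j : Fin n => i + 1 = j.1 ∨ j.1 + 1 = i)).image
              Fin.val).card := (Finset.card_image_of_injective _ Fin.val_injective).symm
          _ ≤ ({i + 1, i - 1} : Finset ℕ).card := by
            apply Finset.card_le_card
            intro x
            simp only [Finset.mem_image, Finset.mem_filter, Finset.mem_univ, true_and,
              Finset.mem_insert, Finset.mem_singleton]
            rintro ⟨j, h, rfl⟩
            omega
          _ ≤ 2 := Finset.card_le_two
    obtain ⟨t, ht, hne, hcard⟩ := hsub
    have hmem : ∀ j ∈ t, (SimpleGraph.pathGraph n).Adj i j := fun j hj => by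
      have : j ∈ (t : Set (Fin n)) := hj
      rwa [ht] at this
    refine ⟨t.image f, by simp [ht], ?_, ?_, ?_⟩
    · intro x hx
      obtain ⟨j, -, rfl⟩ := Finset.mem_image.1 hx
      exact hC j
    · intro hx
      obtain ⟨j, hj, h⟩ := Finset.mem_image.1 hx
      exact hadj i j (hmem j hj) h.symm
    · have h1 := (hne.image f).card_pos
      have h2 := Finset.card_image_le (s := t) (f := f)
      omega
  choose s hs hsC hfs hcard using key
  -- A lone neighbor color is completed to a pair by the vertex's own color. Properness keeps `f i`
  -- out of `s i`, so erasing `f i` from `e i` recovers `s i` in both cases.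
  let e : Fin n → Finset ℕ := fun i => if (s i).card = 1 then insert (f i) (s i) else s i
  have hmaps : ∀ i ∈ (Finset.univ : Finset (Fin n)),
      (f i, e i) ∈ C ×ˢ Finset.powersetCard 2 C := by
    intro i _
    simp only [Finset.mem_product, Finset.mem_powersetCard, e]
    refine ⟨hC i, ?_⟩
    split_ifs with h
    · exact ⟨Finset.insert_subset (hC i) (hsC i), by rw [Finset.card_insert_of_notMem (hfs i), h]⟩
    · exact ⟨hsC i, (hcard i).resolve_left h⟩
  have herase : ∀ i, s i = (e i).erase (f i) := by
    intro i
    simp only [e]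
    split_ifs with h
    · rw [Finset.erase_insert (hfs i)]
    · rw [Finset.erase_eq_of_notMem (hfs i)]
  have hinj : Set.InjOn (fun i => (f i, e i)) ((Finset.univ : Finset (Fin n)) : Set (Fin n)) := by
    intro i _ j _ hij
    simp only [Prod.mk.injEq] at hij
    by_contra hne
    refine hloc i j hne hij.1 ?_
    rw [← hs i, ← hs j, herase i, herase j, hij.1, hij.2]
  have := Finset.card_le_card_of_injOn _ hmaps hinj
  simpa [Finset.card_product, Finset.card_powersetCard] using this

/-! ### From words to colorings -/

theorem isNeighborLocatingColoring_of_word {k n : ℕ} (hn : 2 ≤ n) (W : List ℕ)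
    (hlen : W.length = n + 2) (h0 : W.getD 0 0 = W.getD 2 0)
    (hl : W.getD (n + 1) 0 = W.getD (n - 1) 0) (hnd : (tripleList W).Nodup)
    (htri : ∀ t ∈ tripleList W, t.1 ∈ Finset.Icc 1 k ∧ t.1 ∉ t.2)
    (hmin : ∀ c, n ≤ c * c.choose 2 → k ≤ c) :
    IsNeighborLocatingColoring (SimpleGraph.pathGraph n) k (fun i : Fin n => W.getD (i + 1) 0) := by
  have hget : ∀ i : Fin n, (tripleList W)[i.1]? =
      some (W.getD (i + 1) 0, {W.getD i 0, W.getD (i + 2) 0}) := fun i =>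
    getElem?_tripleList W i (by omega)
  have hmem := fun i => htri _ (List.mem_of_getElem? (hget i))
  simp only [Finset.mem_insert, Finset.mem_singleton, not_or] at hmem
  have hadj : ∀ u v : Fin n, (SimpleGraph.pathGraph n).Adj u v →
      W.getD (u + 1) 0 ≠ W.getD (v + 1) 0 := by
    intro u v h
    rcases SimpleGraph.pathGraph_adj.1 h with h | h
    · rw [← h]; exact (hmem u).2.2
    · rw [← h]; exact fun e => (hmem v).2.2 e.symm
  have hloc : ∀ u v : Fin n, u ≠ v → W.getD (u + 1) 0 = W.getD (v + 1) 0 →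
      (fun i : Fin n => W.getD (i + 1) 0) '' (SimpleGraph.pathGraph n).neighborSet u ≠
      (fun i : Fin n => W.getD (i + 1) 0) '' (SimpleGraph.pathGraph n).neighborSet v := by
    intro u v huv hf h
    rw [pathGraph_neighborSet_image hn (fun i => W.getD i 0) h0 hl,
      pathGraph_neighborSet_image hn (fun i => W.getD i 0) h0 hl] at h
    have h' : ({W.getD u 0, W.getD (u + 2) 0} : Finset ℕ) = {W.getD v 0, W.getD (v + 2) 0} := by
      apply Finset.coe_injective
      simpa using h
    have hlen' := length_tripleList W
    refine huv (Fin.ext ((List.getElem?_inj (by omega) hnd).1 ?_))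
    rw [hget u, hget v, hf, h']
  refine ⟨⟨?_, hadj⟩, hloc⟩
  let C := Finset.univ.image (fun i : Fin n => W.getD (i + 1) 0)
  have hsub : C ⊆ Finset.Icc 1 k := by
    intro x hx
    obtain ⟨i, -, rfl⟩ := Finset.mem_image.1 hx
    exact (hmem i).1
  have hle := hmin _ (le_of_locating hn _ hadj hloc C
    (fun v => Finset.mem_image_of_mem _ (Finset.mem_univ v)))
  have hC : C = Finset.Icc 1 k := Finset.eq_of_subset_of_card_le hsub (by simpa using hle)
  have := congrArg (fun s : Finset ℕ => (s : Set ℕ)) hC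
  simpa [C] using this

/-! ### Inserting triangles and loops into a word -/

/-- The word `W` passes from `a` to `b` away from its ends. -/
def Passes (W : List ℕ) (a b : ℕ) : Prop :=
  ∃ u v : List ℕ, u ≠ [] ∧ 2 ≤ v.length ∧ W = u ++ a :: b :: v

/-- The word `W` encodes a coloring of the path on `n` vertices, extended by one letter at
each end, all of whose triples have their color sets in the family `F`. -/
structure IsLocatingWord (k n : ℕ) (p : List ℕ) (F : Finset (Finset ℕ)) (W : List ℕ) : Prop where
  length_eq : W.length = n + 2
  take_three : W.take 3 = p
  suffix : [k, 2, 1, 2] <:+ W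
  nodup : (tripleList W).Nodup
  mem_triple : ∀ t ∈ tripleList W, t.1 ∈ Finset.Icc 1 k ∧ t.1 ∉ t.2 ∧ insert t.1 t.2 ∈ F
  passes : ∀ s ∈ F, ∀ a ∈ s, ∀ b ∈ s, a ≠ b → Passes W a b ∨ Passes W b a

/-- An insertion happens after `u ++ [a, b]`, which has at least three letters because `u` is
nonempty. -/
theorem take_three_insert {u v x : List ℕ} {a b : ℕ} (hu : u ≠ []) :
    (u ++ a :: b :: x ++ v).take 3 = (u ++ a :: b :: v).take 3 := by
  match u, hu with
  | [_], _ => simp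
  | [_, _], _ => simp
  | _ :: _ :: _ :: _, _ => simp

theorem suffix_insert {k a b : ℕ} {u x v : List ℕ} (hv : 2 ≤ v.length)
    (h : [k, 2, 1, 2] <:+ u ++ a :: b :: v) : [k, 2, 1, 2] <:+ x ++ a :: b :: v :=
  (List.suffix_of_suffix_length_le h (List.suffix_append _ _) (by simpa using hv)).trans
    (List.suffix_append _ _)

/-- By `hx` the inserted block `y` is `x ++ [a, b]`, so the new word contains `a b` twice. Passages
up to the old `a b` survive at the first copy, and those starting later survive at the second. -/
theorem Passes.insert {u v y x : List ℕ} {a b c d : ℕ} (hu : u ≠ []) (hv : 2 ≤ v.length)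
    (hx : x ++ a :: b :: v = y ++ v)
    (h : Passes (u ++ a :: b :: v) c d) : Passes (u ++ a :: b :: (y ++ v)) c d := by
  obtain ⟨u', v', hu', hv', h⟩ := h
  rcases List.append_eq_append_iff.1 h with ⟨t, h1, h2⟩ | ⟨t, h1, h2⟩
  · match t with
    | [] =>
      simp only [List.nil_append, List.cons.injEq] at h2
      obtain ⟨rfl, rfl, -⟩ := h2
      exact ⟨u, y ++ v, hu, by simp; omega, rfl⟩
    | e :: t =>
      simp only [List.cons_append, List.cons.injEq] at h2
      refine ⟨u ++ a :: b :: x ++ e :: t, v', by simp, hv', ?_⟩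
      obtain ⟨rfl, h2⟩ := h2
      rw [← hx, h2]
      simp
  · match t with
    | [] =>
      simp only [List.nil_append, List.cons.injEq] at h2
      obtain ⟨rfl, rfl, -⟩ := h2
      exact ⟨u, y ++ v, hu, by simp; omega, rfl⟩
    | [e] =>
      simp only [List.cons_append, List.nil_append, List.cons.injEq] at h2
      obtain ⟨rfl, rfl, -⟩ := h2
      exact ⟨u', b :: (y ++ v), hu', by simp; omega, by simp [h1]⟩
    | e :: e' :: t =>
      simp only [List.cons_append, List.cons.injEq] at h2
      obtain ⟨rfl, rfl, -⟩ := h2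
      exact ⟨u', t ++ a :: b :: (y ++ v), hu', by simp; omega, by simp [h1]⟩

/-- Going once around the triangle, `a b` becomes `a b c a b`. The new triples have color set `{a,
b, c}`, absent from `F`, so they cannot repeat old ones; the new word also passes along all three
sides. -/
theorem IsLocatingWord.insert_triangle_aux {k n : ℕ} {p : List ℕ} {F : Finset (Finset ℕ)}
    {W : List ℕ} (h : IsLocatingWord k n p F W) {a b c : ℕ} (ha : a ∈ Finset.Icc 1 k)
    (hb : b ∈ Finset.Icc 1 k) (hc : c ∈ Finset.Icc 1 k) (hab : a ≠ b) (hac : a ≠ c) (hbc : b ≠ c)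
    (hF : {a, b, c} ∉ F) (hp : Passes W a b) :
    ∃ W', IsLocatingWord k (n + 3) p (insert {a, b, c} F) W' := by
  obtain ⟨u, v, hu, hv, rfl⟩ := hp
  have e1 : (insert b {a, c} : Finset ℕ) = {a, b, c} := Finset.insert_comm _ _ _
  have e2 : (insert c {b, a} : Finset ℕ) = {a, b, c} := by ext; simp; tauto
  have e3 : (insert a {c, b} : Finset ℕ) = {a, b, c} := by ext; simp; tauto
  have hperm : (tripleList (u ++ a :: b :: ([c, a, b] ++ v))).Perm
      ([(b, {a, c}), (c, {b, a}), (a, {c, b})] ++ tripleList (u ++ a :: b :: v)) := by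
    rw [tripleList_append, tripleList_append a b v u]
    simp only [tripleList, List.cons_append, List.nil_append]
    simpa using (List.perm_append_comm_assoc (tripleList (u ++ [a, b]))
      [(b, {a, c}), (c, {b, a}), (a, {c, b})] (tripleList (a :: b :: v)))
  have hnew : ∀ t ∈ [(b, ({a, c} : Finset ℕ)), (c, {b, a}), (a, {c, b})],
      t.1 ∈ Finset.Icc 1 k ∧ t.1 ∉ t.2 ∧ insert t.1 t.2 = ({a, b, c} : Finset ℕ) := by
    intro t ht
    simp only [List.mem_cons, List.not_mem_nil, or_false] at ht
    rcases ht with rfl | rfl | rfl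
    · exact ⟨hb, by simp [hab.symm, hbc], e1⟩
    · exact ⟨hc, by simp [hac.symm, hbc.symm], e2⟩
    · exact ⟨ha, by simp [hab, hac], e3⟩
  refine ⟨u ++ a :: b :: ([c, a, b] ++ v), ?_, ?_, ?_, ?_, ?_, ?_⟩
  · have := h.length_eq
    simp at this ⊢; omega
  · rw [← h.take_three]
    simpa using take_three_insert (u := u) (v := v) (x := [c, a, b]) (a := a) (b := b) hu
  · simpa using suffix_insert (x := u ++ [a, b, c]) hv h.suffix
  · rw [hperm.nodup_iff, List.nodup_append']
    refine ⟨by simp [hab.symm, hac.symm, hbc], h.nodup, ?_⟩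
    intro t ht ht'
    exact hF ((hnew t ht).2.2 ▸ (h.mem_triple t ht').2.2)
  · intro t ht
    rcases List.mem_append.1 (hperm.mem_iff.1 ht) with ht | ht
    · obtain ⟨h1, h2, h3⟩ := hnew t ht
      exact ⟨h1, h2, h3 ▸ Finset.mem_insert_self _ _⟩
    · obtain ⟨h1, h2, h3⟩ := h.mem_triple t ht
      exact ⟨h1, h2, Finset.mem_insert_of_mem h3⟩
  · intro s hs x hx y hy hxy
    rcases Finset.mem_insert.1 hs with rfl | hs
    · have p1 : Passes (u ++ a :: b :: ([c, a, b] ++ v)) a b :=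
        ⟨u, [c, a, b] ++ v, hu, by simp, rfl⟩
      have p2 : Passes (u ++ a :: b :: ([c, a, b] ++ v)) b c :=
        ⟨u ++ [a], [a, b] ++ v, by simp, by simp, by simp⟩
      have p3 : Passes (u ++ a :: b :: ([c, a, b] ++ v)) c a :=
        ⟨u ++ [a, b], [b] ++ v, by simp, by simp; omega, by simp⟩
      simp only [Finset.mem_insert, Finset.mem_singleton] at hx hy
      rcases hx with rfl | rfl | rfl <;> rcases hy with rfl | rfl | rfl <;>
        first | exact absurd rfl hxy | exact Or.inl ‹_› | exact Or.inr ‹_›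
    · exact (h.passes s hs x hx y hy hxy).imp (Passes.insert (x := [c]) hu hv (by simp))
        (Passes.insert (x := [c]) hu hv (by simp))

theorem IsLocatingWord.insert_loops_aux {k n : ℕ} {p : List ℕ} {F : Finset (Finset ℕ)}
    {W : List ℕ} (h : IsLocatingWord k n p F W) {a b : ℕ} (ha : a ∈ Finset.Icc 1 k)
    (hb : b ∈ Finset.Icc 1 k) (hab : a ≠ b) (hF : {a, b} ∉ F) (hp : Passes W a b) :
    ∃ W', IsLocatingWord k (n + 2) p (insert {a, b} F) W' := by
  obtain ⟨u, v, hu, hv, rfl⟩ := hp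
  have hperm : (tripleList (u ++ a :: b :: ([a, b] ++ v))).Perm
      ([(b, {a}), (a, {b})] ++ tripleList (u ++ a :: b :: v)) := by
    rw [tripleList_append, tripleList_append a b v u]
    simp only [tripleList, List.cons_append, List.nil_append]
    simpa using (List.perm_append_comm_assoc (tripleList (u ++ [a, b]))
      [(b, {a}), (a, {b})] (tripleList (a :: b :: v)))
  have hnew : ∀ t ∈ [(b, ({a} : Finset ℕ)), (a, {b})],
      t.1 ∈ Finset.Icc 1 k ∧ t.1 ∉ t.2 ∧ insert t.1 t.2 = ({a, b} : Finset ℕ) := by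
    intro t ht
    simp only [List.mem_cons, List.not_mem_nil, or_false] at ht
    rcases ht with rfl | rfl
    · exact ⟨hb, by simp [hab.symm], Finset.pair_comm _ _⟩
    · exact ⟨ha, by simp [hab], rfl⟩
  refine ⟨u ++ a :: b :: ([a, b] ++ v), ?_, ?_, ?_, ?_, ?_, ?_⟩
  · have := h.length_eq
    simp at this ⊢; omega
  · rw [← h.take_three]
    simpa using take_three_insert (u := u) (v := v) (x := [a, b]) (a := a) (b := b) hu
  · simpa using suffix_insert (x := u ++ [a, b]) hv h.suffix
  · rw [hperm.nodup_iff, List.nodup_append']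
    refine ⟨by simp [hab.symm], h.nodup, ?_⟩
    intro t ht ht'
    exact hF ((hnew t ht).2.2 ▸ (h.mem_triple t ht').2.2)
  · intro t ht
    rcases List.mem_append.1 (hperm.mem_iff.1 ht) with ht | ht
    · obtain ⟨h1, h2, h3⟩ := hnew t ht
      exact ⟨h1, h2, h3 ▸ Finset.mem_insert_self _ _⟩
    · obtain ⟨h1, h2, h3⟩ := h.mem_triple t ht
      exact ⟨h1, h2, Finset.mem_insert_of_mem h3⟩
  · intro s hs x hx y hy hxy
    rcases Finset.mem_insert.1 hs with rfl | hs
    · have p1 : Passes (u ++ a :: b :: ([a, b] ++ v)) a b :=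
        ⟨u, [a, b] ++ v, hu, by simp, rfl⟩
      simp only [Finset.mem_insert, Finset.mem_singleton] at hx hy
      rcases hx with rfl | rfl <;> rcases hy with rfl | rfl <;>
        first | exact absurd rfl hxy | exact Or.inl ‹_› | exact Or.inr ‹_›
    · exact (h.passes s hs x hx y hy hxy).imp (Passes.insert (x := []) hu hv (by simp))
        (Passes.insert (x := []) hu hv (by simp))

theorem IsLocatingWord.insert_triangle {k n : ℕ} {p : List ℕ} {F : Finset (Finset ℕ)}
    {W : List ℕ} (h : IsLocatingWord k n p F W) {a b c : ℕ} (ha : a ∈ Finset.Icc 1 k)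
    (hb : b ∈ Finset.Icc 1 k) (hc : c ∈ Finset.Icc 1 k) (hab : a ≠ b) (hac : a ≠ c) (hbc : b ≠ c)
    (hF : {a, b, c} ∉ F) {s : Finset ℕ} (hs : s ∈ F) (has : a ∈ s) (hbs : b ∈ s) :
    ∃ W', IsLocatingWord k (n + 3) p (insert {a, b, c} F) W' := by
  rcases h.passes s hs a has b hbs hab with hp | hp
  · exact h.insert_triangle_aux ha hb hc hab hac hbc hF hp
  · rw [Finset.insert_comm a b] at hF ⊢
    exact h.insert_triangle_aux hb ha hc hab.symm hbc hac hF hp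

theorem IsLocatingWord.insert_loops {k n : ℕ} {p : List ℕ} {F : Finset (Finset ℕ)}
    {W : List ℕ} (h : IsLocatingWord k n p F W) {a b : ℕ} (ha : a ∈ Finset.Icc 1 k)
    (hb : b ∈ Finset.Icc 1 k) (hab : a ≠ b) (hF : {a, b} ∉ F) {s : Finset ℕ} (hs : s ∈ F)
    (has : a ∈ s) (hbs : b ∈ s) : ∃ W', IsLocatingWord k (n + 2) p (insert {a, b} F) W' := by
  rcases h.passes s hs a has b hbs hab with hp | hp
  · exact h.insert_loops_aux ha hb hab hF hp
  · rw [Finset.pair_comm a b] at hF ⊢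
    exact h.insert_loops_aux hb ha hab.symm hF hp

/-! ### Adding many triangles and loops -/

/-- Unless all triangles are in `F`, some missing one shares an edge with a member of `F`. -/
theorem exists_adjacent_triangle {k : ℕ} (hk : 3 ≤ k) {F : Finset (Finset ℕ)} (hF : {1, 2, k} ∈ F)
    (hne : (Finset.powersetCard 3 (Finset.Icc 1 k) \ F).Nonempty) :
    ∃ a b c : ℕ, a ∈ Finset.Icc 1 k ∧ b ∈ Finset.Icc 1 k ∧ c ∈ Finset.Icc 1 k ∧ a ≠ b ∧ a ≠ c ∧
      b ≠ c ∧ {a, b, c} ∉ F ∧ ∃ s ∈ F, a ∈ s ∧ b ∈ s := by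
  by_contra! hcon
  obtain ⟨t, ht⟩ := hne
  rw [Finset.mem_sdiff, Finset.mem_powersetCard] at ht
  obtain ⟨⟨hsub, hcard⟩, htF⟩ := ht
  have step : ∀ a b c : ℕ, a ∈ Finset.Icc 1 k → b ∈ Finset.Icc 1 k → c ∈ Finset.Icc 1 k → a ≠ b →
      a ≠ c → b ≠ c → ∀ s ∈ F, a ∈ s → b ∈ s → {a, b, c} ∈ F := by
    intro a b c ha hb hc hab hac hbc s hs has hbs
    by_contra hn
    exact hcon a b c ha hb hc hab hac hbc hn s hs has hbs
  have h1 : 1 ∈ Finset.Icc 1 k := by simp; omega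
  have h2 : 2 ∈ Finset.Icc 1 k := by simp; omega
  -- If `F` cannot be extended, it absorbs every triangle on a covered pair. Coverage spreads from
  -- `{1, 2}` to all pairs containing 1, then to all pairs.
  have s1 : ∀ c ∈ Finset.Icc 1 k, c ≠ 1 → c ≠ 2 → {1, 2, c} ∈ F := fun c hc hc1 hc2 =>
    step 1 2 c h1 h2 hc (by norm_num) hc1.symm hc2.symm _ hF (by simp) (by simp)
  have s2 : ∀ c ∈ Finset.Icc 1 k, c ≠ 1 → ∃ s ∈ F, 1 ∈ s ∧ c ∈ s := by
    intro c hc hc1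
    by_cases hc2 : c = 2
    · exact ⟨_, hF, by simp, by simp [hc2]⟩
    · exact ⟨_, s1 c hc hc1 hc2, by simp, by simp⟩
  have s3 : ∀ c ∈ Finset.Icc 1 k, ∀ d ∈ Finset.Icc 1 k, c ≠ d → ∃ s ∈ F, c ∈ s ∧ d ∈ s := by
    intro c hc d hd hcd
    by_cases hc1 : c = 1
    · subst hc1; exact s2 d hd hcd.symm
    by_cases hd1 : d = 1
    · subst hd1
      obtain ⟨s, hs, h, h'⟩ := s2 c hc hcd
      exact ⟨s, hs, h', h⟩
    obtain ⟨s, hs, h, h'⟩ := s2 c hc hc1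
    exact ⟨_, step 1 c d h1 hc hd (Ne.symm hc1) (Ne.symm hd1) hcd s hs h h', by simp, by simp⟩
  obtain ⟨a, b, c, hab, hac, hbc, rfl⟩ := Finset.card_eq_three.1 hcard
  have ha := hsub (show a ∈ _ by simp)
  have hb := hsub (show b ∈ _ by simp)
  have hc := hsub (show c ∈ _ by simp)
  obtain ⟨s, hs, h, h'⟩ := s3 a ha b hb hab
  exact htF (step a b c ha hb hc hab hac hbc s hs h h')

theorem IsLocatingWord.add_triangles {k n : ℕ} {p : List ℕ} {F : Finset (Finset ℕ)} {W : List ℕ}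
    (hk : 3 ≤ k) (hF : {1, 2, k} ∈ F) (h : IsLocatingWord k n p F W) (y : ℕ)
    (hy : y ≤ (Finset.powersetCard 3 (Finset.Icc 1 k) \ F).card) :
    ∃ F' W', IsLocatingWord k (n + 3 * y) p F' W' ∧ F ⊆ F' ∧
      (Finset.powersetCard 3 (Finset.Icc 1 k) \ F').card + y =
        (Finset.powersetCard 3 (Finset.Icc 1 k) \ F).card ∧
      Finset.powersetCard 2 (Finset.Icc 1 k) \ F' = Finset.powersetCard 2 (Finset.Icc 1 k) \ F := by
  induction y with
  | zero => exact ⟨F, W, h, subset_rfl, rfl, rfl⟩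
  | succ y ih =>
    obtain ⟨F', W', h', hsub, hcard, hedge⟩ := ih (by omega)
    obtain ⟨a, b, c, ha, hb, hc, hab, hac, hbc, hn, s, hs, has, hbs⟩ :=
      exists_adjacent_triangle hk (hsub hF) (Finset.card_pos.1 (by omega))
    obtain ⟨W'', h''⟩ := h'.insert_triangle ha hb hc hab hac hbc hn hs has hbs
    have h3 : ({a, b, c} : Finset ℕ).card = 3 := Finset.card_eq_three.2 ⟨a, b, c, hab, hac, hbc, rfl⟩
    refine ⟨_, W'', h'', hsub.trans (Finset.subset_insert _ _), ?_, ?_⟩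
    · rw [Finset.sdiff_insert, Finset.card_erase_of_mem]
      · omega
      · rw [Finset.mem_sdiff, Finset.mem_powersetCard]
        refine ⟨⟨?_, h3⟩, hn⟩
        intro x hx
        simp only [Finset.mem_insert, Finset.mem_singleton] at hx
        rcases hx with rfl | rfl | rfl <;> assumption
    · rw [Finset.sdiff_insert, hedge, Finset.erase_eq_of_notMem]
      intro hmem
      have := (Finset.mem_powersetCard.1 (Finset.mem_sdiff.1 hmem).1).2
      omega

theorem IsLocatingWord.add_loops {k n : ℕ} {p : List ℕ} {F : Finset (Finset ℕ)} {W : List ℕ}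
    (h : IsLocatingWord k n p F W) (E : Finset (Finset ℕ))
    (hE : E ⊆ Finset.powersetCard 2 (Finset.Icc 1 k) \ F) (hcov : ∀ e ∈ E, ∃ s ∈ F, e ⊆ s) :
    ∃ F' W', IsLocatingWord k (n + 2 * E.card) p F' W' := by
  suffices ∃ W', IsLocatingWord k (n + 2 * E.card) p (F ∪ E) W' from ⟨_, this⟩
  induction E using Finset.induction_on with
  | empty => exact ⟨W, by simpa using h⟩
  | insert e E he ih =>
    obtain ⟨W', h'⟩ := ih ((Finset.subset_insert _ _).trans hE)
      (fun e' he' => hcov e' (Finset.mem_insert_of_mem he'))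
    obtain ⟨s, hs, hes⟩ := hcov e (Finset.mem_insert_self _ _)
    have h1 := Finset.mem_sdiff.1 (hE (Finset.mem_insert_self _ _))
    obtain ⟨hsub, hcard⟩ := Finset.mem_powersetCard.1 h1.1
    obtain ⟨a, b, hab, rfl⟩ := Finset.card_eq_two.1 hcard
    obtain ⟨W'', h''⟩ := h'.insert_loops (hsub (by simp)) (hsub (by simp)) hab
      (by simp only [Finset.mem_union, not_or]; exact ⟨h1.2, he⟩)
      (Finset.mem_union_left _ hs) (hes (by simp)) (hes (by simp))
    refine ⟨W'', ?_⟩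
    rw [Finset.card_insert_of_notMem he, Finset.union_insert]
    exact h''

/-! ### The two starting words -/

theorem isLocatingWord_base {k : ℕ} (hk : 3 ≤ k) :
    IsLocatingWord k 5 [1, 2, 1] {{1, 2}, {1, 2, k}} [1, 2, 1, k, 2, 1, 2] := by
  have e1 : ({1, 1} : Finset ℕ) ≠ {k, 1} := fun h => by
    have : k ∈ ({1, 1} : Finset ℕ) := h ▸ by simp
    simp at this; omega
  have e2 : ({2, k} : Finset ℕ) ≠ {2, 2} := fun h => by
    have : k ∈ ({2, 2} : Finset ℕ) := h ▸ by simp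
    simp at this; omega
  have f0 : ({1, 2} : Finset ℕ) = {2, 1} := by decide
  have f1 : ({1, 2, k} : Finset ℕ) = {k, 1, 2} := by ext; simp; tauto
  have f2 : ({1, 2, k} : Finset ℕ) = {2, k, 1} := by ext; simp; tauto
  refine ⟨rfl, rfl, List.suffix_append [1, 2, 1] _, ?_, ?_, ?_⟩
  · simp only [tripleList, List.nodup_cons, List.mem_cons, Prod.mk.injEq, List.not_mem_nil, e1, e2]
    simp; omega
  · simp only [tripleList, List.forall_mem_cons, List.not_mem_nil]
    refine ⟨⟨?_, by simp, by simp [f0]⟩, ⟨?_, ?_, by simp⟩, ⟨?_, ?_, by simp [f1]⟩,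
      ⟨?_, ?_, by simp [f2]⟩, ⟨?_, by simp, by simp⟩, by simp⟩ <;> simp <;> omega
  · have p1 : Passes [1, 2, 1, k, 2, 1, 2] 2 1 := ⟨[1], [k, 2, 1, 2], by simp, by simp, rfl⟩
    have p2 : Passes [1, 2, 1, k, 2, 1, 2] 1 k := ⟨[1, 2], [2, 1, 2], by simp, by simp, rfl⟩
    have p3 : Passes [1, 2, 1, k, 2, 1, 2] k 2 := ⟨[1, 2, 1], [1, 2], by simp, by simp, rfl⟩
    intro s hs a ha b hb hab
    simp only [Finset.mem_insert, Finset.mem_singleton] at hs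
    rcases hs with rfl | rfl <;> simp only [Finset.mem_insert, Finset.mem_singleton] at ha hb
    · rcases ha with rfl | rfl <;> rcases hb with rfl | rfl <;>
        first | exact absurd rfl hab | exact Or.inl ‹_› | exact Or.inr ‹_›
    · rcases ha with rfl | rfl | rfl <;> rcases hb with rfl | rfl | rfl <;>
        first | exact absurd rfl hab | exact Or.inl ‹_› | exact Or.inr ‹_›

/-- Of the triples with color sets in this family, the word omits only `(2, {1, 3})`. This single
gap produces the length one below the maximum. -/
theorem isLocatingWord_base_of_four_le {k : ℕ} (hk : 4 ≤ k) :
    IsLocatingWord k 9 [2, 3, 2] {{2, 3}, {1, 2}, {1, 2, 3}, {1, 2, k}}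
      [2, 3, 2, 3, 1, 2, 1, k, 2, 1, 2] := by
  have e1 : ({1, 1} : Finset ℕ) ≠ {k, 1} := fun h => by
    have : k ∈ ({1, 1} : Finset ℕ) := h ▸ by simp
    simp at this; omega
  have e2 : ({2, k} : Finset ℕ) ≠ {2, 2} := fun h => by
    have : k ∈ ({2, 2} : Finset ℕ) := h ▸ by simp
    simp at this; omega
  have e3 : ({3, 2} : Finset ℕ) ≠ {2, k} := fun h => by
    have : k ∈ ({3, 2} : Finset ℕ) := h ▸ by simp
    simp at this; omega
  have e4 : ({3, 3} : Finset ℕ) ≠ {k, 1} := fun h => by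
    have : k ∈ ({3, 3} : Finset ℕ) := h ▸ by simp
    simp at this; omega
  have e5 : ({3, 3} : Finset ℕ) ≠ {1, 1} := by decide
  have e6 : ({2, 2} : Finset ℕ) ≠ {2, 1} := by decide
  have e7 : ({3, 2} : Finset ℕ) ≠ {2, 2} := by decide
  have f1 : ({1, 2, k} : Finset ℕ) = {k, 1, 2} := by ext; simp; tauto
  have f2 : ({1, 2, k} : Finset ℕ) = {2, k, 1} := by ext; simp; tauto
  have f3 : ({1, 2, 3} : Finset ℕ) = {3, 2, 1} := by decide
  have f4 : ({1, 2, 3} : Finset ℕ) = {1, 3, 2} := by decide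
  have f5 : ({2, 3} : Finset ℕ) = {3, 2} := by decide
  have f6 : ({1, 2} : Finset ℕ) = {2, 1} := by decide
  refine ⟨rfl, rfl, List.suffix_append [2, 3, 2, 3, 1, 2, 1] _, ?_, ?_, ?_⟩
  · simp only [tripleList, List.nodup_cons, List.mem_cons, Prod.mk.injEq, List.not_mem_nil, e1, e2,
      e3, e4, e5, e6, e7]
    simp; omega
  · simp only [tripleList, List.forall_mem_cons, List.not_mem_nil]
    refine ⟨⟨?_, ?_, by simp [f5]⟩, ⟨?_, ?_, by simp⟩, ⟨?_, ?_, by simp [f3]⟩,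
      ⟨?_, ?_, by simp [f4]⟩, ⟨?_, ?_, by simp [f6]⟩, ⟨?_, ?_, by simp⟩, ⟨?_, ?_, by simp [f1]⟩,
      ⟨?_, ?_, by simp [f2]⟩, ⟨?_, ?_, by simp⟩, by simp⟩ <;> simp <;> omega
  · have p1 : Passes [2, 3, 2, 3, 1, 2, 1, k, 2, 1, 2] 1 2 :=
      ⟨[2, 3, 2, 3], [1, k, 2, 1, 2], by simp, by simp, rfl⟩
    have p2 : Passes [2, 3, 2, 3, 1, 2, 1, k, 2, 1, 2] 1 k :=
      ⟨[2, 3, 2, 3, 1, 2], [2, 1, 2], by simp, by simp, rfl⟩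
    have p3 : Passes [2, 3, 2, 3, 1, 2, 1, k, 2, 1, 2] k 2 :=
      ⟨[2, 3, 2, 3, 1, 2, 1], [1, 2], by simp, by simp, rfl⟩
    have p4 : Passes [2, 3, 2, 3, 1, 2, 1, k, 2, 1, 2] 3 2 :=
      ⟨[2], [3, 1, 2, 1, k, 2, 1, 2], by simp, by simp, rfl⟩
    have p5 : Passes [2, 3, 2, 3, 1, 2, 1, k, 2, 1, 2] 3 1 :=
      ⟨[2, 3, 2], [2, 1, k, 2, 1, 2], by simp, by simp, rfl⟩
    intro s hs a ha b hb hab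
    simp only [Finset.mem_insert, Finset.mem_singleton] at hs
    rcases hs with rfl | rfl | rfl | rfl <;>
      simp only [Finset.mem_insert, Finset.mem_singleton] at ha hb
    · rcases ha with rfl | rfl <;> rcases hb with rfl | rfl <;>
        first | exact absurd rfl hab | exact Or.inl ‹_› | exact Or.inr ‹_›
    · rcases ha with rfl | rfl <;> rcases hb with rfl | rfl <;>
        first | exact absurd rfl hab | exact Or.inl ‹_› | exact Or.inr ‹_›
    all_goals
      rcases ha with rfl | rfl | rfl <;> rcases hb with rfl | rfl | rfl <;>
        first | exact absurd rfl hab | exact Or.inl ‹_› | exact Or.inr ‹_›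

/-! ### Reaching every length from 10 on -/

/-- A pair lies in `k - 2 ≥ 2` triangles, and at most one of them is missing from `F`. -/
theorem exists_superset_of_card_le_one {k : ℕ} (hk : 4 ≤ k) {F : Finset (Finset ℕ)}
    (hF : (Finset.powersetCard 3 (Finset.Icc 1 k) \ F).card ≤ 1) (e : Finset ℕ)
    (he : e ∈ Finset.powersetCard 2 (Finset.Icc 1 k)) : ∃ s ∈ F, e ⊆ s := by
  by_contra! hcon
  obtain ⟨hsub, hcard⟩ := Finset.mem_powersetCard.1 he
  have h1 : 1 < (Finset.Icc 1 k \ e).card := by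
    rw [Finset.card_sdiff_of_subset hsub, hcard, Nat.card_Icc]
    omega
  obtain ⟨c, hc, d, hd, hcd⟩ := Finset.one_lt_card.1 h1
  rw [Finset.mem_sdiff] at hc hd
  have hmem : ∀ x, x ∈ Finset.Icc 1 k → x ∉ e →
      insert x e ∈ Finset.powersetCard 3 (Finset.Icc 1 k) \ F := by
    intro x hx hxe
    rw [Finset.mem_sdiff, Finset.mem_powersetCard, Finset.card_insert_of_notMem hxe, hcard]
    exact ⟨⟨Finset.insert_subset hx hsub, rfl⟩, fun h => hcon _ h (Finset.subset_insert _ _)⟩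
  have heq := Finset.card_le_one.1 hF _ (hmem c hc.1 hc.2) _ (hmem d hd.1 hd.2)
  have : c ∈ insert d e := heq ▸ Finset.mem_insert_self c e
  rcases Finset.mem_insert.1 this with h | h
  · exact hcd h
  · exact hc.2 h

/-- Pairs of a color and a 2-set split by whether the color lies outside the 2-set (three per 3-set)
or inside it (two per 2-set). -/
theorem mul_choose_two_eq (k : ℕ) : k * k.choose 2 = 3 * k.choose 3 + 2 * k.choose 2 := by
  match k with
  | 0 => rfl
  | 1 => rfl
  | k + 2 =>
    have := Nat.choose_succ_right_eq (k + 2) 2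
    rw [Nat.add_sub_cancel] at this
    linarith

theorem exists_locatingWord_of_counts {k n₀ : ℕ} {p : List ℕ} {F : Finset (Finset ℕ)} {W : List ℕ}
    (hk : 4 ≤ k) (hF : {1, 2, k} ∈ F) (h : IsLocatingWord k n₀ p F W)
    {x y : ℕ} (hx : x ≤ (Finset.powersetCard 2 (Finset.Icc 1 k) \ F).card)
    (hy : y ≤ (Finset.powersetCard 3 (Finset.Icc 1 k) \ F).card)
    (hy' : (Finset.powersetCard 3 (Finset.Icc 1 k) \ F).card ≤ y + 1) :
    ∃ F' W', IsLocatingWord k (n₀ + 3 * y + 2 * x) p F' W' := by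
  obtain ⟨F', W', h', hsub, hcard, hedge⟩ := h.add_triangles (by omega) hF y hy
  obtain ⟨E, hE, rfl⟩ := Finset.exists_subset_card_eq hx
  rw [← hedge] at hE
  exact h'.add_loops E hE fun e he => exists_superset_of_card_le_one hk (by omega) e
    (Finset.mem_sdiff.1 (hE he)).1

theorem exists_locatingWord {k n : ℕ} (hk : 4 ≤ k) (hn : 10 ≤ n) (hle : n ≤ k * k.choose 2)
    (hne : n + 1 ≠ k * k.choose 2) : ∃ F W, IsLocatingWord k n [1, 2, 1] F W := by
  rw [mul_choose_two_eq] at hle hne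
  have hbase := isLocatingWord_base (k := k) (by omega)
  have h12k : ({1, 2, k} : Finset ℕ).card = 3 :=
    Finset.card_eq_three.2 ⟨1, 2, k, by omega, by omega, by omega, rfl⟩
  have hT : (Finset.powersetCard 3 (Finset.Icc 1 k) \ {{1, 2}, {1, 2, k}}).card =
      k.choose 3 - 1 := by
    rw [Finset.sdiff_insert, Finset.sdiff_singleton_eq_erase, Finset.erase_eq_of_notMem,
      Finset.card_erase_of_mem, Finset.card_powersetCard, Nat.card_Icc, Nat.add_sub_cancel]
    · rw [Finset.mem_powersetCard]
      refine ⟨?_, h12k⟩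
      intro x hx
      simp at hx ⊢; omega
    · simp [Finset.mem_powersetCard]
  have hE : (Finset.powersetCard 2 (Finset.Icc 1 k) \ {{1, 2}, {1, 2, k}}).card =
      k.choose 2 - 1 := by
    rw [Finset.sdiff_insert, Finset.sdiff_singleton_eq_erase,
      Finset.erase_eq_of_notMem (a := {1, 2, k}), Finset.card_erase_of_mem, Finset.card_powersetCard,
      Nat.card_Icc, Nat.add_sub_cancel]
    · rw [Finset.mem_powersetCard]
      refine ⟨?_, by simp⟩
      intro x hx
      simp at hx ⊢; omega
    · simp [Finset.mem_powersetCard, h12k]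
  have hC : 4 ≤ k.choose 3 := Nat.choose_le_choose 3 hk
  have hmem : ({1, 2, k} : Finset ℕ) ∈ ({{1, 2}, {1, 2, k}} : Finset (Finset ℕ)) := by simp
  rcases Nat.lt_or_ge n (2 + 3 * k.choose 3) with hlt | hge
  · obtain ⟨x, y, hx, hy, hxy⟩ : ∃ x y, x ≤ 2 ∧ y ≤ k.choose 3 - 1 ∧ n = 5 + 3 * y + 2 * x :=
      -- As 2 is its own inverse modulo 3, this `x` satisfies `2 * x ≡ n - 5` modulo 3. At most two
      -- loop insertions are needed, and `{1, k}`, `{2, k}` are available at once inside `{1, 2,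
      -- k}`.
      ⟨2 * ((n - 5) % 3) % 3, (n - 5 - 2 * (2 * ((n - 5) % 3) % 3)) / 3, by omega, by omega,
        by omega⟩
    obtain ⟨F', W', h', hsub, -, hedge⟩ := hbase.add_triangles (by omega) hmem y (by omega)
    have hcard : ({{1, k}, {2, k}} : Finset (Finset ℕ)).card = 2 := by
      refine Finset.card_pair fun h => ?_
      have : 1 ∈ ({2, k} : Finset ℕ) := h ▸ by simp
      simp at this; omega
    obtain ⟨E, hEsub, rfl⟩ := Finset.exists_subset_card_eq (hx.trans hcard.ge)
    rw [hxy]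
    refine h'.add_loops E ?_ ?_
    · rw [hedge]
      refine hEsub.trans fun e he => ?_
      have hk1 : 1 ≠ k := by omega
      have hk2 : 2 ≠ k := by omega
      have hn : ∀ e : Finset ℕ, k ∈ e → e.card = 2 →
          e ∉ ({{1, 2}, {1, 2, k}} : Finset (Finset ℕ)) := by
        intro e hke hec h
        simp only [Finset.mem_insert, Finset.mem_singleton] at h
        rcases h with rfl | rfl
        · simp at hke; omega
        · omega
      simp only [Finset.mem_insert, Finset.mem_singleton] at he
      rw [Finset.mem_sdiff, Finset.mem_powersetCard]
      rcases he with rfl | rfl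
      · refine ⟨⟨fun x hx => ?_, Finset.card_pair hk1⟩, hn _ (by simp) (Finset.card_pair hk1)⟩
        simp at hx ⊢; omega
      · refine ⟨⟨fun x hx => ?_, Finset.card_pair hk2⟩, hn _ (by simp) (Finset.card_pair hk2)⟩
        simp at hx ⊢; omega
    · intro e he
      refine ⟨{1, 2, k}, hsub hmem, fun x hx => ?_⟩
      have := hEsub he
      simp only [Finset.mem_insert, Finset.mem_singleton] at this
      rcases this with rfl | rfl <;> simp at hx ⊢ <;> tauto
  · obtain ⟨x, y, hx, hy, hy', rfl⟩ : ∃ x y, x ≤ k.choose 2 - 1 ∧ y ≤ k.choose 3 - 1 ∧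
        k.choose 3 - 1 ≤ y + 1 ∧ n = 5 + 3 * y + 2 * x := by
      -- Parity decides whether all triangles are used or one is left out. In the odd case, `hne`
      -- excludes the one length that would need too many loops.
      rcases Nat.mod_two_eq_zero_or_one (n - 2 - 3 * k.choose 3) with h | h
      · exact ⟨(n - 2 - 3 * k.choose 3) / 2, k.choose 3 - 1, by omega, by omega, by omega, by omega⟩
      · exact ⟨(n + 1 - 3 * k.choose 3) / 2, k.choose 3 - 2, by omega, by omega, by omega, by omega⟩
    exact exists_locatingWord_of_counts hk hmem hbase (by omega) (by omega) (by omega)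

theorem exists_locatingWord_of_succ_eq {k n : ℕ} (hk : 4 ≤ k) (hn : n + 1 = k * k.choose 2) :
    ∃ F W, IsLocatingWord k n [2, 3, 2] F W := by
  rw [mul_choose_two_eq] at hn
  have hbase := isLocatingWord_base_of_four_le hk
  have h12k : ({1, 2, k} : Finset ℕ).card = 3 :=
    Finset.card_eq_three.2 ⟨1, 2, k, by omega, by omega, by omega, rfl⟩
  have hne : ({1, 2, 3} : Finset ℕ) ≠ {1, 2, k} := fun h => by
    have : k ∈ ({1, 2, 3} : Finset ℕ) := h ▸ by simp
    simp at this; omega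
  have hI : ∀ s : Finset ℕ, s ⊆ {1, 2, 3, k} → s ⊆ Finset.Icc 1 k := fun s hs =>
    hs.trans fun x hx => by simp at hx ⊢; omega
  have hT : k.choose 3 - 2 ≤ (Finset.powersetCard 3 (Finset.Icc 1 k) \
      {{2, 3}, {1, 2}, {1, 2, 3}, {1, 2, k}}).card ∧ (Finset.powersetCard 3 (Finset.Icc 1 k) \
      {{2, 3}, {1, 2}, {1, 2, 3}, {1, 2, k}}).card ≤ k.choose 3 - 2 := by
    rw [← le_antisymm_iff, eq_comm, Finset.sdiff_insert, Finset.sdiff_insert,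
      Finset.erase_eq_of_notMem, Finset.erase_eq_of_notMem, Finset.card_sdiff_of_subset,
      Finset.card_pair hne, Finset.card_powersetCard, Nat.card_Icc, Nat.add_sub_cancel]
    · intro s hs
      simp only [Finset.mem_insert, Finset.mem_singleton] at hs
      rw [Finset.mem_powersetCard]
      rcases hs with rfl | rfl
      · exact ⟨hI _ (by intro x hx; simp at hx ⊢; tauto), rfl⟩
      · exact ⟨hI _ (by intro x hx; simp at hx ⊢; tauto), h12k⟩
    · simp [Finset.mem_powersetCard]
    · simp [Finset.mem_powersetCard]
  have hE : k.choose 2 - 2 ≤ (Finset.powersetCard 2 (Finset.Icc 1 k) \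
      {{2, 3}, {1, 2}, {1, 2, 3}, {1, 2, k}}).card := by
    calc k.choose 2 - 2 = (Finset.powersetCard 2 (Finset.Icc 1 k)).card -
          ({{2, 3}, {1, 2}} : Finset (Finset ℕ)).card := by
          rw [Finset.card_powersetCard, Nat.card_Icc, Nat.add_sub_cancel]; rfl
      _ ≤ (Finset.powersetCard 2 (Finset.Icc 1 k) \ {{2, 3}, {1, 2}}).card :=
        Finset.le_card_sdiff _ _
      _ ≤ _ := by
        refine Finset.card_le_card fun s hs => ?_
        rw [Finset.mem_sdiff, Finset.mem_powersetCard] at hs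
        rw [Finset.mem_sdiff, Finset.mem_powersetCard]
        refine ⟨hs.1, fun h => ?_⟩
        simp only [Finset.mem_insert, Finset.mem_singleton] at h
        rcases h with h | h | rfl | rfl
        · exact hs.2 (by simp [h])
        · exact hs.2 (by simp [h])
        · exact absurd hs.1.2 (by decide)
        · omega
  have hC : 4 ≤ k.choose 3 := Nat.choose_le_choose 3 hk
  have hC2 : 6 ≤ k.choose 2 := Nat.choose_le_choose 2 hk
  have : n = 9 + 3 * (k.choose 3 - 2) + 2 * (k.choose 2 - 2) := by omega
  rw [this]
  exact exists_locatingWord_of_counts hk (by simp) hbase hE hT.1 (by omega)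

/-! ### Colorings of all paths and the final theorem -/

theorem half_cube_sub_sq (k : ℕ) :
    1 / 2 * ((k : ℚ) ^ 3 - (k : ℚ) ^ 2) = ((k * k.choose 2 : ℕ) : ℚ) := by
  rw [Nat.cast_mul, Nat.cast_choose_two]
  ring

theorem IsLocatingWord.exists_coloring {k n : ℕ} {p : List ℕ} {F : Finset (Finset ℕ)} {W : List ℕ}
    (hn : 2 ≤ n) (h : IsLocatingWord k n p F W) (hp : p.getD 0 0 = p.getD 2 0)
    (hmin : ∀ c, n ≤ c * c.choose 2 → k ≤ c) :
    IsNeighborLocatingColoring (SimpleGraph.pathGraph n) k (fun i : Fin n => W.getD (i + 1) 0) ∧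
      W.getD (n - 2) 0 = k ∧ W.getD (n - 1) 0 = 2 ∧ W.getD n 0 = 1 ∧
      W.getD 1 0 = p.getD 1 0 ∧ W.getD 2 0 = p.getD 2 0 := by
  have htake : ∀ i < 3, W.getD i 0 = p.getD i 0 := by
    intro i hi
    rw [← h.take_three]
    simp [List.getD, hi]
  have hlen := h.length_eq
  obtain ⟨t, ht⟩ := h.suffix
  have htl : t.length + 2 = n := by
    -- The suffix starts at index `n - 2`, so its letters `k`, 2, 1 color the last three vertices
    -- and its final 2 is the reflected letter.
    rw [← ht] at hlen; simp at hlen; omega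
  have hsuf : ∀ i, W.getD (t.length + i) 0 = [k, 2, 1, 2].getD i 0 := by
    intro i
    rw [← ht]
    simp [List.getD, List.getElem?_append_right]
  have h0 := hsuf 0
  have h1 := hsuf 1
  have h2 := hsuf 2
  have h3 := hsuf 3
  subst htl
  refine ⟨isNeighborLocatingColoring_of_word hn W hlen ?_ ?_ h.nodup
    (fun t ht => ⟨(h.mem_triple t ht).1, (h.mem_triple t ht).2.1⟩) hmin, h0, h1, h2,
    htake 1 (by omega), htake 2 (by omega)⟩
  · rw [htake 0 (by omega), htake 2 (by omega), hp]
  · exact h3.trans h1.symm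

theorem exists_short_coloring {m n : ℕ} (hn : 2 ≤ n) (hn9 : n ≤ 9) (hle : n ≤ m * m.choose 2)
    (hmin : ∀ c, n ≤ c * c.choose 2 → m ≤ c) :
    ∃ g : ℕ → ℕ,
      IsNeighborLocatingColoring (SimpleGraph.pathGraph n) m (fun i : Fin n => g (i + 1)) ∧
      g (n - 1) = 2 ∧ g n = 1 ∧ (9 ≤ n → g (n - 2) = m) ∧ (9 ≤ n → g 1 = 2 ∧ g 2 = 1) := by
  suffices ∃ W : List ℕ, W.length = n + 2 ∧ W.getD 0 0 = W.getD 2 0 ∧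
      W.getD (n + 1) 0 = W.getD (n - 1) 0 ∧ (tripleList W).Nodup ∧
      (∀ t ∈ tripleList W, t.1 ∈ Finset.Icc 1 m ∧ t.1 ∉ t.2) ∧ W.getD (n - 1) 0 = 2 ∧
      W.getD n 0 = 1 ∧ (9 ≤ n → W.getD (n - 2) 0 = m) ∧
      (9 ≤ n → W.getD 1 0 = 2 ∧ W.getD 2 0 = 1) by
    obtain ⟨W, h1, h2, h3, h4, h5, h6⟩ := this
    exact ⟨fun i => W.getD i 0, isNeighborLocatingColoring_of_word hn W h1 h2 h3 h4 h5 hmin, h6⟩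
  have hm : m ≤ 3 := hmin 3 hn9
  rcases Nat.lt_or_ge 2 n with h | h
  · have hm3 : m = 3 := by
      interval_cases m <;> simp at hle ⊢ <;> omega
    subst hm3
    clear hle hmin hm
    interval_cases n
    · exact ⟨[2, 3, 2, 1, 2], by decide⟩
    · exact ⟨[3, 1, 3, 2, 1, 2], by decide⟩
    · exact ⟨[1, 2, 1, 3, 2, 1, 2], by decide⟩
    · exact ⟨[2, 3, 2, 3, 1, 2, 1, 2], by decide⟩
    · exact ⟨[1, 2, 1, 3, 1, 3, 2, 1, 2], by decide⟩
    · exact ⟨[2, 3, 2, 3, 1, 3, 1, 2, 1, 2], by decide⟩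
    · exact ⟨[1, 2, 1, 3, 1, 3, 2, 3, 2, 1, 2], by decide⟩
  · obtain rfl : n = 2 := by omega
    have hm2 : m = 2 := by
      have := hmin 2 (by decide)
      interval_cases m <;> simp at hle ⊢
    subst hm2
    exact ⟨[1, 2, 1, 2], by decide⟩

theorem exists_coloring {m n : ℕ} (hn : 2 ≤ n) (hle : n ≤ m * m.choose 2)
    (hmin : ∀ c, n ≤ c * c.choose 2 → m ≤ c) :
    ∃ g : ℕ → ℕ,
      IsNeighborLocatingColoring (SimpleGraph.pathGraph n) m (fun i : Fin n => g (i + 1)) ∧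
      g (n - 1) = 2 ∧ g n = 1 ∧ (9 ≤ n → g (n - 2) = m) ∧
      (9 ≤ n → n + 1 ≠ m * m.choose 2 → g 1 = 2 ∧ g 2 = 1) := by
  rcases Nat.lt_or_ge 9 n with h | h
  · have hm : 4 ≤ m := by
      by_contra hm
      have : m ≤ 3 := by omega
      interval_cases m <;> simp [Nat.choose] at hle <;> omega
    by_cases hT : n + 1 = m * m.choose 2
    · obtain ⟨F, W, hW⟩ := exists_locatingWord_of_succ_eq hm hT
      obtain ⟨h1, h2, h3, h4, -, -⟩ := hW.exists_coloring hn rfl hmin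
      exact ⟨fun i => W.getD i 0, h1, h3, h4, fun _ => h2, fun _ h => absurd hT h⟩
    · obtain ⟨F, W, hW⟩ := exists_locatingWord hm h hle hT
      obtain ⟨h1, h2, h3, h4, h5, h6⟩ := hW.exists_coloring hn rfl hmin
      exact ⟨fun i => W.getD i 0, h1, h3, h4, fun _ => h2, fun _ _ => ⟨h5, h6⟩⟩
  · obtain ⟨g, h1, h2, h3, h4, h5⟩ := exists_short_coloring hn h hle hmin
    exact ⟨g, h1, h2, h3, h4, fun h9 _ => h5 h9⟩

theorem theorem2 (n : ℕ) (hn : 2 ≤ n) :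
    ∃ m : ℕ,
      IsLeast {k : ℕ | (n : ℚ) ≤ 1 / 2 * ((k : ℚ) ^ 3 - (k : ℚ) ^ 2)} m ∧
      neighborLocatingChromaticNumber (SimpleGraph.pathGraph n) = (m : ℕ∞) ∧
      ∃ f : Fin n → ℕ,
        IsNeighborLocatingColoring (SimpleGraph.pathGraph n) m f ∧
        f ⟨n - 2, by omega⟩ = 2 ∧
        f ⟨n - 1, by omega⟩ = 1 ∧
        (9 ≤ n → f ⟨n - 3, by omega⟩ = m) ∧
        (9 ≤ n → (n : ℚ) ≠ 1 / 2 * ((m : ℚ) ^ 3 - (m : ℚ) ^ 2) - 1 →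
          f ⟨0, by omega⟩ = 2 ∧ f ⟨1, by omega⟩ = 1) := by
  have hex : ∃ k : ℕ, n ≤ k * k.choose 2 :=
    ⟨n, Nat.le_mul_of_pos_right n (Nat.choose_pos hn)⟩
  obtain ⟨m, hle, hmin⟩ : ∃ m, n ≤ m * m.choose 2 ∧ ∀ c, n ≤ c * c.choose 2 → m ≤ c := by
    classical
    exact ⟨Nat.find hex, Nat.find_spec hex, fun c hc => Nat.find_min' hex hc⟩
  obtain ⟨g, hg, h1, h2, h3, h4⟩ := exists_coloring hn hle hmin
  simp only [half_cube_sub_sq, Nat.cast_le]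
  refine ⟨m, ⟨hle, fun c hc => hmin c hc⟩, ?_, fun i => g (i + 1), hg, ?_, ?_, ?_, ?_⟩
  · refine le_antisymm (iInf₂_le m ⟨_, hg⟩) (le_iInf₂ fun k hk => ?_)
    obtain ⟨f, ⟨hrange, hadj⟩, hloc⟩ := hk
    have := le_of_locating hn f hadj hloc (Finset.Icc 1 k) fun v => by
      have : f v ∈ Set.Icc 1 k := hrange ▸ Set.mem_range_self v
      simpa using this
    rw [Nat.card_Icc, Nat.add_sub_cancel] at this
    exact_mod_cast hmin k this
  · exact (congrArg g (show n - 2 + 1 = n - 1 by omega)).trans h1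
  · exact (congrArg g (show n - 1 + 1 = n by omega)).trans h2
  · exact fun h9 => (congrArg g (show n - 3 + 1 = n - 2 by omega)).trans (h3 h9)
  · intro h9 hne
    refine h4 h9 fun h => hne ?_
    rw [← h]
    push_cast
    ring
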